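/- Let $G$ be a finite simple graph with maximum degree $\Delta(G)$, and let $\chi_G$ be its chromatic polynomial, i.e. the unique monic polynomial of degree $|V(G)|$ such that, for every positive integer $q$, $\chi_G(q)$ is the number of proper $q$-colorings of $G$. If $z\in\mathbb{C}$ satisfies $\chi_G(z)=0$, then $|z|\leq 4.25\,\Delta(G)$. -/

import Mathlib

open Polynomial

/-- `p` is a chromatic polynomial of the finite graph `G` on `n` vertices: it is monic of degree
`n`, and for every positive integer `q` its value at `q` is the number of proper `q`-colorings
of `G`. -/
def SimpleGraph.IsChromaticPolynomial {V : Type*} [Fintype V] (G : SimpleGraph V)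
    (p : ℂ[X]) : Prop :=
  p.Monic ∧ p.natDegree = Fintype.card V ∧
    ∀ q : ℕ, 0 < q → p.eval (q : ℂ) = (Nat.card (G.Coloring (Fin q)) : ℂ)

/-- Colorings are sorted by the partition into color classes that they induce. -/
theorem SimpleGraph.card_coloring_eq_sum_setoid {V : Type*} [Fintype V] (G : SimpleGraph V)
    (S : Finset (Setoid V)) (hS : ∀ s, s ∈ S ↔ ∀ u v, G.Adj u v → ¬ s u v) (q : ℕ) :
    Nat.card (G.Coloring (Fin q)) = ∑ s ∈ S, q.descFactorial (Nat.card (Quotient s)) := by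
  classical
  have e : G.Coloring (Fin q) ≃ Σ s : S, (Quotient s.1 ↪ Fin q) :=
    { toFun := fun c => ⟨⟨Setoid.ker c, (hS _).2 fun u v h => c.valid h⟩,
        ⟨Quotient.lift c fun _ _ h => h, by
          intro x y
          induction x using Quotient.inductionOn
          induction y using Quotient.inductionOn
          intro h
          exact Quotient.sound h⟩⟩
      invFun := fun p => SimpleGraph.Coloring.mk (fun v => p.2 (Quotient.mk p.1.1 v)) (by
        intro u v h h'
        exact (hS _).1 p.1.2 u v h (Quotient.exact (p.2.injective h')))
      left_inv := fun c => by
        ext v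
        rfl
      right_inv := by
        rintro ⟨⟨s, hs⟩, f⟩
        have h : Setoid.ker (fun v => f (Quotient.mk s v)) = s := by
          ext u v
          refine ⟨fun h => Quotient.exact (f.injective h), fun h => ?_⟩
          exact congrArg f (Quotient.sound h)
        refine Sigma.ext (Subtype.ext h) ?_
        refine Function.Embedding.casesOn f ?_ h
        intro f hf h
        have key : ∀ (t : Setoid V) (_ : t = s) (g : Quotient t ↪ Fin q),
            (∀ v, g (Quotient.mk t v) = f (Quotient.mk s v)) →
            HEq g (⟨f, hf⟩ : Quotient s ↪ Fin q) := by
          intro t ht g hg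
          subst ht
          apply heq_of_eq
          ext x
          induction x using Quotient.inductionOn
          rw [hg]
          rfl
        exact key _ h _ fun v => rfl }
  rw [Nat.card_congr e, Nat.card_sigma, ← Finset.sum_coe_sort S]
  refine Finset.sum_congr rfl fun s _ => ?_
  rw [Nat.card_eq_fintype_card, Fintype.card_embedding_eq, Fintype.card_fin,
    Nat.card_eq_fintype_card]

/-- A finite graph has exactly one chromatic polynomial. -/
theorem SimpleGraph.existsUnique_isChromaticPolynomial {V : Type*} [Fintype V]
    (G : SimpleGraph V) : ∃! p : ℂ[X], G.IsChromaticPolynomial p := by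
  classical
  have fin : Finite (Setoid V) :=
    Finite.of_injective (fun s : Setoid V => fun u v => s u v) fun s t h =>
      Setoid.ext fun u v => iff_of_eq (congrFun (congrFun h u) v)
  have := Fintype.ofFinite (Setoid V)
  let S : Finset (Setoid V) := Finset.univ.filter fun s => ∀ u v, G.Adj u v → ¬ s u v
  have hS : ∀ s, s ∈ S ↔ ∀ u v, G.Adj u v → ¬ s u v := fun s => by simp [S]
  have hbot : (⊥ : Setoid V) ∈ S := (hS _).2 fun u v h h' => h.ne h'
  let p : ℂ[X] := ∑ s ∈ S, descPochhammer ℂ (Nat.card (Quotient s))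
  have hp : p = descPochhammer ℂ (Fintype.card V) +
      ∑ s ∈ S.erase ⊥, descPochhammer ℂ (Nat.card (Quotient s)) := by
    have h : Nat.card (Quotient (⊥ : Setoid V)) = Fintype.card V := by
      rw [← Nat.card_eq_fintype_card]
      exact (Nat.card_congr (Equiv.ofBijective (Quotient.mk (⊥ : Setoid V))
        ⟨fun _ _ h => Quotient.exact h, Quotient.mk_surjective⟩)).symm
    rw [← h]
    exact (Finset.add_sum_erase S _ hbot).symm
  have hdeg : (∑ s ∈ S.erase ⊥, descPochhammer ℂ (Nat.card (Quotient s))).degree <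
      (descPochhammer ℂ (Fintype.card V)).degree := by
    rw [degree_eq_natDegree (monic_descPochhammer ℂ _).ne_zero, descPochhammer_natDegree]
    refine (Polynomial.degree_sum_le _ _).trans_lt ?_
    rw [Finset.sup_lt_iff (WithBot.bot_lt_coe _)]
    intro s hs
    rw [degree_eq_natDegree (monic_descPochhammer ℂ _).ne_zero, descPochhammer_natDegree]
    have hne := (Finset.mem_erase.1 hs).1
    norm_cast
    rw [Nat.card_eq_fintype_card]
    refine lt_of_le_of_ne (Fintype.card_le_of_surjective _ Quotient.mk_surjective) fun h => hne ?_
    have hb := (Fintype.bijective_iff_surjective_and_card (Quotient.mk s)).2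
      ⟨Quotient.mk_surjective, h.symm⟩
    exact eq_bot_iff.2 fun u v h2 => hb.1 (Quotient.sound h2)
  refine ⟨p, ⟨?_, ?_, ?_⟩, ?_⟩
  · rw [hp]
    exact (monic_descPochhammer ℂ _).add_of_left hdeg
  · rw [hp, natDegree_add_eq_left_of_degree_lt hdeg, descPochhammer_natDegree]
  · intro q _
    rw [G.card_coloring_eq_sum_setoid S hS q]
    simp only [p, eval_finsetSum, descPochhammer_eval_eq_descFactorial, Nat.cast_sum]
  · rintro r ⟨-, -, hr⟩
    refine Polynomial.eq_of_infinite_eval_eq _ _ ?_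
    refine Set.Infinite.mono (s := Set.range fun k : ℕ => ((k + 1 : ℕ) : ℂ)) ?_
      (Set.infinite_range_of_injective fun a b h => by simpa using h)
    rintro _ ⟨k, rfl⟩
    change r.eval ((k + 1 : ℕ) : ℂ) = p.eval ((k + 1 : ℕ) : ℂ)
    rw [hr (k + 1) k.succ_pos, G.card_coloring_eq_sum_setoid S hS]
    simp only [p, eval_finsetSum, descPochhammer_eval_eq_descFactorial, Nat.cast_sum]

/-- The chromatic polynomial of a finite graph `G`, as a complex polynomial. -/
noncomputable def SimpleGraph.chromaticPolynomial {V : Type*} [Fintype V] (G : SimpleGraph V) :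
    ℂ[X] :=
  G.existsUnique_isChromaticPolynomial.choose

theorem SimpleGraph.isChromaticPolynomial_chromaticPolynomial {V : Type*} [Fintype V]
    (G : SimpleGraph V) : G.IsChromaticPolynomial G.chromaticPolynomial :=
  G.existsUnique_isChromaticPolynomial.choose_spec.1

/-!
Let `Z G = χ_G(q) / q ^ |V|` and `z = -1 / q`. Deletion–contraction reads
`Z (K + ab) = Z K + z * Z (K / ab)`, where `K / ab` identifies the vertices `a` and `b`; isolated
vertices do not change `Z`, so all graphs are taken on the same vertex type. Write `Δ = m + 1` for
the maximum degree. It is enough to bound `Z (K / ab)` by `r ^ m * Z K` in norm, where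
`‖z‖ * r ^ m ≤ ε` and `r = 1 / (1 - ε)`: then deleting an edge increases `‖Z‖` by a factor of `r` at
most, and since `Z ⊥ = 1`, `Z` does not vanish.

The bound on identifications is proved by induction along subgraphs. To identify `v` with `u` in `H`,
first delete the edges from `v` to common neighbors (a factor `r` each, by induction), and then move
the other edges of `v` to `u`, one at a time. Each move costs a factor `r` as well
(`SimpleGraph.shiftBound_of_lt`), and there are at most `m` edges in all.

For one move, from the edge `v x` to the edge `u x`, expand both graphs by deletion–contraction along
the edges at `x`, so that `x` grows into a cluster `R` (`SimpleGraph.norm_attach_sub_attach_le`). If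
the final cluster sees both or none of `u` and `v`, then the two expansions agree; otherwise they
differ by `± z * Z (H' - R + uv)`, where `H'` is `H` with the edges moved so far. In particular the
cluster `R = {x}` does not contribute, because `x` is adjacent to neither `u` nor `v` before the edge
is attached. By induction `Z (H' - R + uv)` is bounded in terms of `Z (H - R)`, and removing a further
vertex of a cluster costs `r ^ m`, as it has at most `m` neighbors outside the cluster. Each vertex of
the cluster therefore carries a weight `ε`, and the clusters are dominated by rooted trees in which
vertices have at most `m` children: if `(1 + ε y) ^ m ≤ y`, their total weight without the cluster
`{x}` is at most `y - 1`. The move is as cheap as claimed if `(y - 1) * (1 + ε) ≤ 1`.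

With `ε = 1 / (3 Δ)` and `y = 2 - ε` all the conditions hold as soon as `‖q‖ ≥ 4.25 Δ`.
-/

namespace SimpleGraph

variable {V : Type*}

/-! ### Operations on graphs -/

/-- The identification of the non-adjacent vertices `a` and `b` of `K`: the vertex `a` takes over
the neighbors of `b`. The vertex `b` is kept as an isolated vertex, so that all the graphs of the
argument live on one vertex type. -/
def identify (K : SimpleGraph V) (a b : V) : SimpleGraph V where
  Adj s t := s ≠ t ∧ s ≠ b ∧ t ≠ b ∧ (K.Adj s t ∨ (s = a ∧ K.Adj b t) ∨ (t = a ∧ K.Adj b s))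
  symm := ⟨by intro s t; simp only [K.adj_comm s t]; tauto⟩
  loopless := ⟨by tauto⟩

/-- The removal of a set `R` of vertices, which stay as isolated vertices. -/
def isolate (K : SimpleGraph V) (R : Finset V) : SimpleGraph V where
  Adj s t := K.Adj s t ∧ s ∉ R ∧ t ∉ R
  symm := ⟨by intro s t; simp only [K.adj_comm s t]; tauto⟩
  loopless := ⟨fun s h => h.1.ne rfl⟩

/-- The deletion of the edges from `y` to the elements of `Q`. -/
def detach (K : SimpleGraph V) (y : V) (Q : Finset V) : SimpleGraph V where
  Adj s t := K.Adj s t ∧ ¬(s = y ∧ t ∈ Q) ∧ ¬(t = y ∧ s ∈ Q)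
  symm := ⟨by intro s t; simp only [K.adj_comm s t]; tauto⟩
  loopless := ⟨fun s h => h.1.ne rfl⟩

/-- The addition of edges from `y` to the elements of `Q`. -/
def attach (K : SimpleGraph V) (y : V) (Q : Finset V) : SimpleGraph V where
  Adj s t := K.Adj s t ∨ (s ≠ t ∧ ((s = y ∧ t ∈ Q) ∨ (t = y ∧ s ∈ Q)))
  symm := ⟨by intro s t; simp only [K.adj_comm s t]; tauto⟩
  loopless := ⟨fun s h => h.elim (fun h => h.ne rfl) (fun h => h.1 rfl)⟩

/-- The transfer of the edges from `v` to `X` to the vertex `u`. -/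
def shift (K : SimpleGraph V) (u v : V) (X : Finset V) : SimpleGraph V :=
  (K.detach v X).attach u X

open Classical in
/-- The neighbors of a vertex, as a `Finset` that does not depend on decidability instances. -/
noncomputable def nbrs [Fintype V] (K : SimpleGraph V) (v : V) : Finset V :=
  Finset.univ.filter (K.Adj v)

@[simp] theorem mem_nbrs [Fintype V] {K : SimpleGraph V} {v w : V} :
    w ∈ K.nbrs v ↔ K.Adj v w := by simp [nbrs]

theorem identify_adj {K : SimpleGraph V} {a b s t : V} : (K.identify a b).Adj s t ↔
    s ≠ t ∧ s ≠ b ∧ t ≠ b ∧ (K.Adj s t ∨ (s = a ∧ K.Adj b t) ∨ (t = a ∧ K.Adj b s)) := Iff.rfl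

theorem isolate_adj {K : SimpleGraph V} {R : Finset V} {s t : V} :
    (K.isolate R).Adj s t ↔ K.Adj s t ∧ s ∉ R ∧ t ∉ R := Iff.rfl

theorem detach_adj {K : SimpleGraph V} {y : V} {Q : Finset V} {s t : V} :
    (K.detach y Q).Adj s t ↔ K.Adj s t ∧ ¬(s = y ∧ t ∈ Q) ∧ ¬(t = y ∧ s ∈ Q) := Iff.rfl

theorem attach_adj {K : SimpleGraph V} {y : V} {Q : Finset V} {s t : V} :
    (K.attach y Q).Adj s t ↔
      K.Adj s t ∨ (s ≠ t ∧ ((s = y ∧ t ∈ Q) ∨ (t = y ∧ s ∈ Q))) := Iff.rfl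

theorem isolate_le (K : SimpleGraph V) (R : Finset V) : K.isolate R ≤ K := fun _ _ h => h.1

theorem detach_le (K : SimpleGraph V) (y : V) (Q : Finset V) : K.detach y Q ≤ K :=
  fun _ _ h => h.1

theorem nbrs_subset_of_le [Fintype V] {K H : SimpleGraph V} (h : K ≤ H) (v : V) :
    K.nbrs v ⊆ H.nbrs v := fun w hw => by
  rw [mem_nbrs] at hw ⊢
  exact h hw

theorem card_nbrs_le_of_le [Fintype V] {K H : SimpleGraph V} (h : K ≤ H) (v : V) :
    (K.nbrs v).card ≤ (H.nbrs v).card :=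
  Finset.card_le_card (nbrs_subset_of_le h v)

/-! ### Deletion and contraction -/

/-- Deletion–contraction for numbers of colorings. The factor `q` counts the colors of the isolated
vertex that `identify` leaves behind. -/
theorem card_coloring_identify [Finite V] (K : SimpleGraph V) {a b : V} (hab : a ≠ b)
    (hK : ¬K.Adj a b) (q : ℕ) :
    q * Nat.card (K.Coloring (Fin q)) = q * Nat.card ((K ⊔ edge a b).Coloring (Fin q)) +
      Nat.card ((K.identify a b).Coloring (Fin q)) := by
  classical
  have e : K.Coloring (Fin q) ≃
      (K ⊔ edge a b).Coloring (Fin q) ⊕ {c : K.Coloring (Fin q) // c a = c b} :=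
    { toFun := fun c => if h : c a = c b then Sum.inr ⟨c, h⟩ else
        Sum.inl (Coloring.mk c (by
          intro s t hst
          rw [sup_adj, edge_adj] at hst
          rcases hst with hst | ⟨⟨rfl, rfl⟩ | ⟨rfl, rfl⟩, -⟩
          · exact c.valid hst
          · exact h
          · exact Ne.symm h))
      invFun := Sum.elim
        (fun c : (K ⊔ edge a b).Coloring (Fin q) =>
          Coloring.mk c fun hst => c.valid (Or.inl hst)) Subtype.val
      left_inv := fun c => by
        by_cases h : c a = c b
        · simp [h]
        · simp only [h, dite_false]
          rfl
      right_inv := by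
        rintro (c | c)
        · have h : c a ≠ c b := c.valid (by simp [edge_adj, hab])
          exact dif_neg h
        · simp [c.2] }
  have e' : Fin q × {c : K.Coloring (Fin q) // c a = c b} ≃ (K.identify a b).Coloring (Fin q) :=
    { toFun := fun p => Coloring.mk (Function.update p.2.1 b p.1) (by
        rintro s t ⟨hst, hs, ht, h⟩
        rw [Function.update_of_ne hs, Function.update_of_ne ht]
        rcases h with h | ⟨rfl, h⟩ | ⟨rfl, h⟩
        · exact p.2.1.valid h
        · rw [p.2.2]
          exact p.2.1.valid h
        · rw [p.2.2]
          exact (p.2.1.valid h).symm)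
      invFun := fun c => (c b, ⟨Coloring.mk (Function.update c b (c a)) (by
        intro s t h
        by_cases hs : s = b
        · subst hs
          have ht : t ≠ s := h.ne'
          have hta : a ≠ t := by rintro rfl; exact hK h.symm
          rw [Function.update_self, Function.update_of_ne ht]
          exact c.valid ⟨hta, hab, ht, Or.inr (Or.inl ⟨rfl, h⟩)⟩
        · by_cases ht : t = b
          · subst ht
            have hta : s ≠ a := by rintro rfl; exact hK h
            rw [Function.update_self, Function.update_of_ne hs]
            exact c.valid ⟨hta, hs, hab, Or.inr (Or.inr ⟨rfl, h.symm⟩)⟩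
          · rw [Function.update_of_ne hs, Function.update_of_ne ht]
            exact c.valid ⟨h.ne, hs, ht, Or.inl h⟩),
        by
          change Function.update c b (c a) a = Function.update c b (c a) b
          rw [Function.update_self, Function.update_of_ne hab]⟩)
      left_inv := by
        rintro ⟨i, c, hc⟩
        refine Prod.ext ?_ (Subtype.ext ?_)
        · change Function.update c b i b = i
          exact Function.update_self _ _ _
        ext s
        change Fin.val (Function.update (Function.update c b i) b (Function.update c b i a) s) = _
        by_cases hs : s = b
        · subst hs
          rw [Function.update_self, Function.update_of_ne hab, hc]
        · rw [Function.update_of_ne hs, Function.update_of_ne hs]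
      right_inv := by
        intro c
        ext s
        change Fin.val (Function.update (Function.update c b (c a)) b (c b) s) = _
        by_cases hs : s = b
        · subst hs
          rw [Function.update_self]
        · rw [Function.update_of_ne hs, Function.update_of_ne hs] }
  have : Finite (K.Coloring (Fin q)) := Finite.of_injective _ DFunLike.coe_injective
  have : Finite ((K ⊔ edge a b).Coloring (Fin q)) := Finite.of_injective _ DFunLike.coe_injective
  rw [Nat.card_congr e, Nat.card_sum, mul_add, ← Nat.card_congr e', Nat.card_prod, Nat.card_fin]

/-- Deletion–contraction for the chromatic polynomial, with a factor `X` for the isolated vertex that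
`identify` leaves behind. -/
theorem chromaticPolynomial_identify [Fintype V] (K : SimpleGraph V) {a b : V} (hab : a ≠ b)
    (hK : ¬K.Adj a b) :
    X * K.chromaticPolynomial =
      X * (K ⊔ edge a b).chromaticPolynomial + (K.identify a b).chromaticPolynomial := by
  refine Polynomial.eq_of_infinite_eval_eq _ _ ?_
  refine Set.Infinite.mono (s := Set.range fun k : ℕ => ((k + 1 : ℕ) : ℂ)) ?_
    (Set.infinite_range_of_injective fun a b h => by simpa using h)
  rintro _ ⟨k, rfl⟩
  simp only [Set.mem_ofPred_eq, eval_mul, eval_add, eval_X]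
  rw [K.isChromaticPolynomial_chromaticPolynomial.2.2 _ k.succ_pos,
    (K ⊔ edge a b).isChromaticPolynomial_chromaticPolynomial.2.2 _ k.succ_pos,
    (K.identify a b).isChromaticPolynomial_chromaticPolynomial.2.2 _ k.succ_pos]
  exact_mod_cast K.card_coloring_identify hab hK (k + 1)

theorem chromaticPolynomial_bot [Fintype V] :
    (⊥ : SimpleGraph V).chromaticPolynomial = X ^ Fintype.card V := by
  classical
  refine (existsUnique_isChromaticPolynomial (⊥ : SimpleGraph V)).unique
    (isChromaticPolynomial_chromaticPolynomial _) ⟨monic_X_pow _, natDegree_X_pow _, ?_⟩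
  intro q _
  have e : (⊥ : SimpleGraph V).Coloring (Fin q) ≃ (V → Fin q) :=
    { toFun := fun c => c
      invFun := fun c => Coloring.mk c fun h => h.elim
      left_inv := fun c => rfl
      right_inv := fun c => rfl }
  rw [Nat.card_congr e, Nat.card_eq_fintype_card]
  simp

/-- The chromatic polynomial at `q`, normalized to take the value `1` on edgeless graphs. -/
noncomputable def normalizedChromatic [Fintype V] (q : ℂ) (K : SimpleGraph V) : ℂ :=
  K.chromaticPolynomial.eval q / q ^ Fintype.card V

theorem normalizedChromatic_bot [Fintype V] {q : ℂ} (hq : q ≠ 0) :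
    normalizedChromatic q (⊥ : SimpleGraph V) = 1 := by
  rw [normalizedChromatic, chromaticPolynomial_bot, eval_pow, eval_X, div_self (pow_ne_zero _ hq)]

theorem normalizedChromatic_sup_edge [Fintype V] {q : ℂ} (hq : q ≠ 0) (K : SimpleGraph V) {a b : V}
    (hab : a ≠ b) (hK : ¬K.Adj a b) :
    normalizedChromatic q (K ⊔ edge a b) =
      normalizedChromatic q K + -q⁻¹ * normalizedChromatic q (K.identify a b) := by
  have h := congrArg (eval q) (K.chromaticPolynomial_identify hab hK)
  simp only [eval_mul, eval_add, eval_X] at h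
  simp only [normalizedChromatic]
  field_simp
  linear_combination -h

/-! ### Identities between modified graphs -/

section
variable [DecidableEq V]

theorem isolate_insert (H : SimpleGraph V) [Fintype V] (R : Finset V) (n : V) :
    H.isolate (insert n R) = (H.isolate R).detach n ((H.isolate R).nbrs n) := by
  ext s t
  simp only [isolate_adj, detach_adj, mem_nbrs, Finset.mem_insert]
  have := H.adj_comm s t
  grind

theorem detach_insert_sup_edge (H : SimpleGraph V) {y q : V} {Q : Finset V} (hq : q ∉ Q)
    (h : H.Adj y q) : H.detach y Q = H.detach y (insert q Q) ⊔ edge y q := by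
  ext s t
  simp only [sup_adj, edge_adj, detach_adj, Finset.mem_insert]
  have := H.adj_comm s t
  have := h.ne
  have := H.ne_of_adj (a := s) (b := t)
  grind

theorem attach_insert (K : SimpleGraph V) {x n : V} {P : Finset V} :
    K.attach x (insert n P) = K.attach x P ⊔ edge x n := by
  ext s t
  simp only [sup_adj, edge_adj, attach_adj, Finset.mem_insert]
  grind

omit [DecidableEq V] in
theorem not_attach_adj {K : SimpleGraph V} {x n : V} {P : Finset V} (hK : ¬K.Adj x n)
    (hx : x ∉ P) (hn : n ∉ P) : ¬(K.attach x P).Adj x n := by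
  simp only [attach_adj]
  grind

/-- Contracting the edge from the cluster `x` to `n` lets the cluster absorb `n`. -/
theorem identify_attach_isolate [Fintype V] (A : SimpleGraph V) {x n : V} {R P : Finset V}
    (hx : x ∈ R) (hnR : n ∉ R) (hP : Disjoint P R) (hn : n ∉ P) :
    ((A.isolate R).attach x P).identify x n =
      (A.isolate (insert n R)).attach x (P ∪ (A.isolate R).nbrs n) := by
  ext s t
  simp only [identify_adj, attach_adj, isolate_adj, Finset.mem_insert, Finset.mem_union, mem_nbrs]
  have h1 := A.adj_comm s t
  have h2 := A.ne_of_adj (a := s) (b := t)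
  have hs : s ∈ P → s ∉ R := fun h => Finset.disjoint_left.1 hP h
  have ht : t ∈ P → t ∉ R := fun h => Finset.disjoint_left.1 hP h
  have h3 := A.adj_comm n t
  have h4 := A.adj_comm n s
  have h5 := A.loopless.irrefl n
  grind

omit [DecidableEq V] in
/-- Contracting the edge from `x` to a vertex `u` different from its other neighbor `v` turns the
path `u`, `x`, `v` into the edge `u v`. -/
theorem identify_attach_singleton (A : SimpleGraph V) {x u v : V} (hux : u ≠ x) (hvx : v ≠ x)
    (hx : ∀ w, ¬A.Adj x w) :
    (A.attach x {v}).identify u x = A ⊔ edge u v := by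
  ext s t
  simp only [identify_adj, attach_adj, sup_adj, edge_adj, Finset.mem_singleton]
  have h1 := A.adj_comm s t
  have h2 := A.ne_of_adj (a := s) (b := t)
  have h3 := hx t
  have h4 := hx s
  grind

omit [DecidableEq V] in
theorem identify_shift [Fintype V] (H : SimpleGraph V) {u v : V} {X : Finset V}
    (huv : u ≠ v) (hX : X ⊆ H.nbrs v) : (H.shift u v X).identify u v = H.identify u v := by
  ext s t
  simp only [shift, identify_adj, attach_adj, detach_adj]
  have hs : s ∈ X → H.Adj v s := fun h => mem_nbrs.1 (hX h)
  have ht : t ∈ X → H.Adj v t := fun h => mem_nbrs.1 (hX h)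
  grind

theorem isolate_shift (H : SimpleGraph V) {u v : V} {X R : Finset V} (hu : u ∉ R) :
    (H.shift u v X).isolate R = (H.isolate R).shift u v (X \ R) := by
  ext s t
  simp only [shift, isolate_adj, attach_adj, detach_adj, Finset.mem_sdiff]
  grind

theorem attach_isolate_shift_left [Fintype V] (H : SimpleGraph V) {u v x : V} {X : Finset V}
    (hvx : H.Adj v x) (hu : u ≠ x) (hX : X ⊆ H.nbrs v) :
    ((H.shift u v X).isolate {x}).attach x (insert u ((H.nbrs x).erase v)) =
      H.shift u v (insert x X) := by
  ext s t
  simp only [shift, isolate_adj, attach_adj, detach_adj, Finset.mem_insert, Finset.mem_singleton,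
    Finset.mem_erase, mem_nbrs]
  have h1 := H.adj_comm s t
  have h2 := H.ne_of_adj (a := s) (b := t)
  have h3 := hvx.ne
  have h4 := H.adj_comm u x
  have h5 := H.adj_comm v x
  have hs : s ∈ X → H.Adj v s := fun h => mem_nbrs.1 (hX h)
  have ht : t ∈ X → H.Adj v t := fun h => mem_nbrs.1 (hX h)
  grind

theorem attach_isolate_shift_right [Fintype V] (H : SimpleGraph V) {u v x : V} {X : Finset V}
    (hvx : H.Adj v x) (hu : u ≠ x) (hx : x ∉ X) :
    ((H.shift u v X).isolate {x}).attach x (insert v ((H.nbrs x).erase v)) = H.shift u v X := by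
  ext s t
  simp only [shift, isolate_adj, attach_adj, detach_adj, Finset.mem_insert, Finset.mem_singleton,
    Finset.mem_erase, mem_nbrs]
  have h1 := H.adj_comm s t
  have h2 := H.ne_of_adj (a := s) (b := t)
  have h3 := hvx.ne
  have h5 := H.adj_comm v x
  grind

/-- When the common neighbors of `u` and `v` are detached from `v` and the other neighbors of `v`
are moved to `u`, the result is the identification of `u` and `v`. -/
theorem shift_detach_eq_identify [Fintype V] (H : SimpleGraph V) {u v : V} (huv : u ≠ v) :
    (H.detach v (H.nbrs v ∩ H.nbrs u)).shift u v (H.nbrs v \ H.nbrs u) = H.identify u v := by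
  ext s t
  simp only [shift, identify_adj, attach_adj, detach_adj, Finset.mem_inter, Finset.mem_sdiff,
    mem_nbrs]
  have h1 := H.adj_comm s t
  have h2 := H.ne_of_adj (a := s) (b := t)
  have h3 := H.adj_comm u v
  have h4 := H.loopless.irrefl v
  grind

end

/-! ### Comparison of two attachments of a vertex -/

/-- The graph function `Z` satisfies the deletion–contraction recursion with parameter `z`. -/
def DeletionContraction (z : ℂ) (Z : SimpleGraph V → ℂ) : Prop :=
  ∀ (K : SimpleGraph V) (a b : V), a ≠ b → ¬K.Adj a b →
    Z (K ⊔ edge a b) = Z K + z * Z (K.identify a b)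

/-- An edge from `x` to `u` matters, when `x` is adjacent to `v` only, through the graph in which the
edge `u v` replaces `x`. -/
theorem DeletionContraction.attach_pair [DecidableEq V] {z : ℂ} {Z : SimpleGraph V → ℂ}
    (hZ : DeletionContraction z Z)
    {A : SimpleGraph V} {x u v : V} (hux : u ≠ x) (hvx : v ≠ x) (huv : u ≠ v)
    (hx : ∀ w, ¬A.Adj x w) :
    Z (A.attach x {u, v}) - Z (A.attach x {v}) = z * Z (A ⊔ edge u v) := by
  rw [attach_insert, edge_comm, hZ _ _ _ hux, identify_attach_singleton A hux hvx hx,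
    add_sub_cancel_left]
  rw [adj_comm]
  exact not_attach_adj (hx u) (by simpa using hvx.symm) (by simpa using huv)

theorem DeletionContraction.attach_singleton [DecidableEq V] {z : ℂ} {Z : SimpleGraph V → ℂ}
    (hZ : DeletionContraction z Z) {A : SimpleGraph V} {x u : V} (hux : u ≠ x)
    (hx : ∀ w, ¬A.Adj x w) : Z (A.attach x {u}) = Z A + z * Z A := by
  have h1 : A.attach x {u} = A ⊔ edge u x := by
    ext s t
    simp only [attach_adj, sup_adj, edge_adj, Finset.mem_singleton]
    grind
  have h2 : A.identify u x = A := by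
    ext s t
    simp only [identify_adj]
    have h1 := A.adj_comm s t
    have h2 := A.ne_of_adj (a := s) (b := t)
    have h3 := hx t
    have h4 := hx s
    grind
  rw [h1, hZ _ _ _ hux fun h => hx _ h.symm, h2]

/-- Comparison of the two attachments of a cluster `x` to `u` and to `v`. The set `R` consists of the
vertices that the cluster has absorbed (with `x` itself), `P` consists of the neighbors of the
cluster, and `b` bounds the contribution of a final cluster. The second bound, for a cluster adjacent
to neither `u` nor `v`, lacks the contribution of the cluster that absorbs nothing more: there the
two attachments have the same value. -/
theorem norm_attach_sub_attach_le [Fintype V] [DecidableEq V] {z : ℂ} {Z : SimpleGraph V → ℂ}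
    (hZ : DeletionContraction z Z) (A : SimpleGraph V) {x u v : V} (hux : u ≠ x) (hvx : v ≠ x)
    (huv : u ≠ v) {ε y : ℝ} {m : ℕ} (hε : 0 ≤ ε) (hy : 0 ≤ y) (hym : (1 + ε * y) ^ m ≤ y)
    (b : Finset V → ℝ)
    (hb : ∀ R, x ∈ R → u ∉ R → v ∉ R → ‖Z (A.isolate R ⊔ edge u v)‖ ≤ b R)
    (hstep : ∀ R n, x ∈ R → u ∉ R → v ∉ R → n ∉ R → n ≠ u → n ≠ v → (∃ s ∈ R, A.Adj s n) →
      ‖z‖ * b (insert n R) ≤ ε * b R)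
    (hdeg : ∀ n, n ≠ u → n ≠ v → (A.nbrs n \ {u, v}).card ≤ m + 1)
    (R P : Finset V) (hxR : x ∈ R) (huR : u ∉ R) (hvR : v ∉ R) (hPR : Disjoint P R)
    (hP : ∀ n ∈ P, n ≠ u → n ≠ v → ∃ s ∈ R, A.Adj s n) :
    ‖Z ((A.isolate R).attach x (insert u P)) - Z ((A.isolate R).attach x (insert v P))‖ ≤
        ‖z‖ * ((1 + ε * y) ^ (P \ {u, v}).card * b R) ∧
      (u ∉ P → v ∉ P →
        ‖Z ((A.isolate R).attach x (insert u P)) - Z ((A.isolate R).attach x (insert v P))‖ ≤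
          ‖z‖ * (((1 + ε * y) ^ (P \ {u, v}).card - 1) * b R)) := by
  induction hc : Rᶜ.card using Nat.strong_induction_on generalizing R P with
  | _ c ihR =>
  subst hc
  have hbR : 0 ≤ b R := (norm_nonneg _).trans (hb R hxR huR hvR)
  have hxA : ∀ w, ¬(A.isolate R).Adj x w := fun w h => h.2.1 hxR
  have hxP : x ∉ P := fun h => Finset.disjoint_left.1 hPR h hxR
  induction hd : (P \ {u, v}).card generalizing P with
  | zero =>
    have hsub : P ⊆ {u, v} := by
      rwa [Finset.card_eq_zero, Finset.sdiff_eq_empty_iff_subset] at hd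
    simp only [pow_zero, one_mul, sub_self, zero_mul, mul_zero]
    have hnn : 0 ≤ ‖z‖ * b R := mul_nonneg (norm_nonneg _) hbR
    by_cases hu : u ∈ P
    · refine ⟨?_, fun h => absurd hu h⟩
      by_cases hv : v ∈ P
      · rwa [Finset.insert_eq_of_mem hu, Finset.insert_eq_of_mem hv, sub_self, norm_zero]
      · have : P = {u} := by grind
        subst this
        have h := hZ.attach_pair hvx hux huv.symm hxA
        rw [Finset.pair_eq_singleton, norm_sub_rev, h, norm_mul, edge_comm]
        exact mul_le_mul_of_nonneg_left (hb R hxR huR hvR) (norm_nonneg _)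
    · by_cases hv : v ∈ P
      · refine ⟨?_, fun _ h => absurd hv h⟩
        have : P = {v} := by grind
        subst this
        have h := hZ.attach_pair hux hvx huv hxA
        rw [Finset.pair_eq_singleton, h, norm_mul]
        exact mul_le_mul_of_nonneg_left (hb R hxR huR hvR) (norm_nonneg _)
      · have : P = ∅ := by grind
        subst this
        rw [insert_empty_eq, insert_empty_eq, hZ.attach_singleton hux hxA,
          hZ.attach_singleton hvx hxA, sub_self, norm_zero]
        exact ⟨hnn, fun _ _ => le_rfl⟩
  | succ k ihP =>
    obtain ⟨n, hn⟩ : (P \ {u, v}).Nonempty := by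
      rw [← Finset.card_pos]
      omega
    simp only [Finset.mem_sdiff, Finset.mem_insert, Finset.mem_singleton, not_or] at hn
    obtain ⟨hnP, hnu, hnv⟩ := hn
    replace hnu : n ≠ u := hnu
    replace hnv : n ≠ v := hnv
    have hnR : n ∉ R := Finset.disjoint_left.1 hPR hnP
    have hxn : x ≠ n := fun h => hnR (h ▸ hxR)
    obtain ⟨P', hnP', rfl⟩ : ∃ P', n ∉ P' ∧ P = insert n P' :=
      ⟨P.erase n, Finset.notMem_erase _ _, (Finset.insert_erase hnP).symm⟩
    have hd' : (P' \ {u, v}).card = k := by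
      rw [Finset.insert_sdiff_of_notMem _ (by simp [hnu, hnv]),
        Finset.card_insert_of_notMem (by simp [hnP'])] at hd
      omega
    have hP'R : Disjoint P' R := hPR.mono_left (Finset.subset_insert _ _)
    set N := (A.isolate R).nbrs n with hN
    have key : ∀ w, w ≠ x → w ∉ R → w ≠ n →
        Z ((A.isolate R).attach x (insert w (insert n P'))) =
          Z ((A.isolate R).attach x (insert w P')) +
            z * Z ((A.isolate (insert n R)).attach x (insert w (P' ∪ N))) := by
      intro w hwx hwR hwn
      rw [Finset.insert_comm, attach_insert, hZ _ _ _ hxn, identify_attach_isolate A hxR hnR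
        (Finset.disjoint_insert_left.2 ⟨hwR, hP'R⟩) (by simp [hwn.symm, hnP']),
        Finset.insert_union]
      refine not_attach_adj (hxA n) ?_ (by simp [hwn.symm, hnP'])
      simp only [Finset.mem_insert, not_or] at hxP ⊢
      exact ⟨hwx.symm, hxP.2⟩
    have hcR : (insert n R)ᶜ.card < Rᶜ.card := by
      refine Finset.card_lt_card ?_
      rw [Finset.compl_ssubset_compl]
      exact Finset.ssubset_insert hnR
    have hdisj : Disjoint (P' ∪ N) (insert n R) := by
      rw [Finset.disjoint_left]
      intro w hw
      rw [Finset.mem_union, hN, mem_nbrs] at hw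
      rw [Finset.mem_insert, not_or]
      rcases hw with hw | hw
      · exact ⟨fun h => hnP' (h ▸ hw), Finset.disjoint_left.1 hP'R hw⟩
      · exact ⟨hw.ne', hw.2.2⟩
    have hnew := (ihR _ hcR (insert n R) (P' ∪ N) (Finset.mem_insert_of_mem hxR)
      (by simp [hnu.symm, huR]) (by simp [hnv.symm, hvR]) hdisj (by
        intro w hw hwu hwv
        rcases Finset.mem_union.1 hw with hw | hw
        · obtain ⟨s, hs, h⟩ := hP w (Finset.mem_insert_of_mem hw) hwu hwv
          exact ⟨s, Finset.mem_insert_of_mem hs, h⟩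
        · exact ⟨n, Finset.mem_insert_self _ _, (mem_nbrs.1 hw).1⟩) rfl).1
    obtain ⟨s, hsR, hsn⟩ := hP n (Finset.mem_insert_self _ _) hnu hnv
    -- The neighbor `s` of `n` lies in the cluster, so `n` brings at most `m` new neighbors.
    have hNm : (N \ {u, v}).card ≤ m := by
      have hlt : (N \ {u, v}).card < (A.nbrs n \ {u, v}).card := by
        refine Finset.card_lt_card (Finset.ssubset_iff_of_subset ?_ |>.2 ⟨s, ?_, ?_⟩)
        · refine Finset.sdiff_subset_sdiff (fun w hw => ?_) subset_rfl
          exact mem_nbrs.2 (mem_nbrs.1 hw).1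
        · simp only [Finset.mem_sdiff, mem_nbrs, Finset.mem_insert, Finset.mem_singleton, not_or]
          exact ⟨hsn.symm, fun h => huR (h ▸ hsR), fun h => hvR (h ▸ hsR)⟩
        · intro h
          exact (mem_nbrs.1 (Finset.mem_sdiff.1 h).1).2.2 hsR
      have := hdeg n hnu hnv
      omega
    have hcard : ((P' ∪ N) \ {u, v}).card ≤ k + m := by
      rw [Finset.union_sdiff_distrib]
      exact (Finset.card_union_le _ _).trans (by omega)
    have h1 : 1 ≤ 1 + ε * y := le_add_of_nonneg_right (mul_nonneg hε hy)
    have hbn := hstep R n hxR huR hvR hnR hnu hnv ⟨s, hsR, hsn⟩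
    have hbn0 : 0 ≤ b (insert n R) := (norm_nonneg _).trans (hb _ (Finset.mem_insert_of_mem hxR)
      (by simp [hnu.symm, huR]) (by simp [hnv.symm, hvR]))
    have hnew' : ‖z‖ * ‖Z ((A.isolate (insert n R)).attach x (insert u (P' ∪ N))) -
        Z ((A.isolate (insert n R)).attach x (insert v (P' ∪ N)))‖ ≤
          ‖z‖ * ((1 + ε * y) ^ k * (ε * y) * b R) := by
      refine mul_le_mul_of_nonneg_left (hnew.trans ?_) (norm_nonneg _)
      calc ‖z‖ * ((1 + ε * y) ^ ((P' ∪ N) \ {u, v}).card * b (insert n R))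
          ≤ ‖z‖ * ((1 + ε * y) ^ (k + m) * b (insert n R)) := by gcongr
        _ = (1 + ε * y) ^ k * (1 + ε * y) ^ m * (‖z‖ * b (insert n R)) := by ring
        _ ≤ (1 + ε * y) ^ k * y * (ε * b R) := by gcongr
        _ = (1 + ε * y) ^ k * (ε * y) * b R := by ring
    have htri : ‖Z ((A.isolate R).attach x (insert u (insert n P'))) -
        Z ((A.isolate R).attach x (insert v (insert n P')))‖ ≤
        ‖Z ((A.isolate R).attach x (insert u P')) - Z ((A.isolate R).attach x (insert v P'))‖ +
          ‖z‖ * ‖Z ((A.isolate (insert n R)).attach x (insert u (P' ∪ N))) -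
            Z ((A.isolate (insert n R)).attach x (insert v (P' ∪ N)))‖ := by
      rw [key u hux huR hnu.symm, key v hvx hvR hnv.symm, ← norm_mul]
      refine le_trans (le_of_eq ?_) (norm_add_le _ _)
      congr 1
      ring
    obtain ⟨hold, hold'⟩ := ihP P' hP'R (fun w hw => hP w (Finset.mem_insert_of_mem hw))
      (fun h => hxP (Finset.mem_insert_of_mem h)) hd'
    refine ⟨(htri.trans (add_le_add hold hnew')).trans (le_of_eq (by ring)), fun hu hv => ?_⟩
    have := hold' (fun h => hu (Finset.mem_insert_of_mem h))
      (fun h => hv (Finset.mem_insert_of_mem h))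
    exact (htri.trans (add_le_add this hnew')).trans (le_of_eq (by ring))

/-! ### Ratios of the values on a graph and its modifications -/

/-- Identifying two non-adjacent vertices, one of degree at most `m`, costs a factor `r ^ m`. -/
def IdentifyBound [Fintype V] (Z : SimpleGraph V → ℂ) (m : ℕ) (r : ℝ) (H : SimpleGraph V) : Prop :=
  ∀ u v, u ≠ v → ¬H.Adj u v → (H.nbrs v).card ≤ m → ‖Z (H.identify u v)‖ ≤ r ^ m * ‖Z H‖

/-- Transferring edges from `v` to a vertex `u` not adjacent to `v`, without creating double edges,
costs a factor `r` per edge, when `v` has degree at most `m`. -/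
def ShiftBound [Fintype V] (Z : SimpleGraph V → ℂ) (m : ℕ) (r : ℝ) (H : SimpleGraph V) : Prop :=
  ∀ u v X, u ≠ v → ¬H.Adj u v → (H.nbrs v).card ≤ m → X ⊆ H.nbrs v → Disjoint X (H.nbrs u) →
    ‖Z (H.shift u v X)‖ ≤ r ^ X.card * ‖Z H‖

/-- Deleting edges at a vertex costs a factor `r` per edge, given the bounds on identifications in
smaller graphs. -/
theorem norm_detach_le [Fintype V] [DecidableEq V] {z : ℂ} {Z : SimpleGraph V → ℂ}
    (hZ : DeletionContraction z Z) {ε r : ℝ} {m : ℕ} (hr : 1 ≤ r)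
    (hrε : r * (1 - ε) = 1) (hz : ‖z‖ * r ^ m ≤ ε) {H : SimpleGraph V}
    (hH : ∀ w, (H.nbrs w).card ≤ m + 1) (hI : ∀ K < H, IdentifyBound Z m r K) (y : V)
    (Q : Finset V) (hQ : Q ⊆ H.nbrs y) : ‖Z (H.detach y Q)‖ ≤ r ^ Q.card * ‖Z H‖ := by
  induction Q using Finset.induction_on with
  | empty =>
    have : H.detach y ∅ = H := by ext s t; simp [detach_adj]
    simp [this]
  | insert q Q hq ih =>
    rw [Finset.insert_subset_iff, mem_nbrs] at hQ
    have hsup := H.detach_insert_sup_edge hq hQ.1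
    have hK : ¬(H.detach y (insert q Q)).Adj y q := by simp [detach_adj]
    have hlt : H.detach y (insert q Q) < H := by
      refine lt_of_le_of_ne (H.detach_le _ _) fun h => hK ?_
      rw [h]
      exact hQ.1
    have hcard : ((H.detach y (insert q Q)).nbrs y).card ≤ m := by
      refine Nat.le_of_lt_succ (lt_of_lt_of_le (Finset.card_lt_card ?_) (hH y))
      refine Finset.ssubset_iff_of_subset (nbrs_subset_of_le (H.detach_le _ _) y) |>.2
        ⟨q, mem_nbrs.2 hQ.1, ?_⟩
      rwa [mem_nbrs]
    have h1 := hI _ hlt q y hQ.1.ne' (fun h => hK h.symm) hcard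
    have h2 := hZ _ q y hQ.1.ne' fun h => hK h.symm
    rw [edge_comm, ← hsup] at h2
    have h3 : ‖z * Z ((H.detach y (insert q Q)).identify q y)‖ ≤
        ε * ‖Z (H.detach y (insert q Q))‖ := by
      rw [norm_mul]
      calc _ ≤ ‖z‖ * (r ^ m * ‖Z (H.detach y (insert q Q))‖) := by gcongr
        _ = ‖z‖ * r ^ m * ‖Z (H.detach y (insert q Q))‖ := by ring
        _ ≤ _ := by gcongr
    have h4 : (1 - ε) * ‖Z (H.detach y (insert q Q))‖ ≤ ‖Z (H.detach y Q)‖ := by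
      have := norm_sub_le_norm_add (Z (H.detach y (insert q Q)))
        (z * Z ((H.detach y (insert q Q)).identify q y))
      rw [← h2] at this
      linarith
    calc ‖Z (H.detach y (insert q Q))‖ = r * ((1 - ε) * ‖Z (H.detach y (insert q Q))‖) := by
          rw [← mul_assoc, hrε, one_mul]
      _ ≤ r * ‖Z (H.detach y Q)‖ := by gcongr
      _ ≤ r * (r ^ Q.card * ‖Z H‖) := by gcongr; exact ih hQ.2
      _ = r ^ (insert q Q).card * ‖Z H‖ := by
        rw [Finset.card_insert_of_notMem hq, pow_succ]
        ring

theorem norm_isolate_insert_le [Fintype V] [DecidableEq V] {z : ℂ} {Z : SimpleGraph V → ℂ}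
    (hZ : DeletionContraction z Z) {ε r : ℝ} {m : ℕ} (hr : 1 ≤ r)
    (hrε : r * (1 - ε) = 1) (hz : ‖z‖ * r ^ m ≤ ε) {H : SimpleGraph V}
    (hH : ∀ w, (H.nbrs w).card ≤ m + 1) (hI : ∀ K < H, IdentifyBound Z m r K) (R : Finset V)
    (n : V) {d : ℕ} (hd : ((H.isolate R).nbrs n).card ≤ d) :
    ‖Z (H.isolate (insert n R))‖ ≤ r ^ d * ‖Z (H.isolate R)‖ := by
  rw [isolate_insert]
  refine (norm_detach_le hZ hr hrε hz
    (fun w => (card_nbrs_le_of_le (H.isolate_le R) w).trans (hH w))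
    (fun K hK => hI K (hK.trans_le (H.isolate_le R))) n _ subset_rfl).trans ?_
  gcongr

/-- The induction step for transfers: the values before and after the transfer of one edge are compared
through the clusters that grow from its endpoint `x`. -/
theorem shiftBound_of_lt [Fintype V] [DecidableEq V] {z : ℂ} {Z : SimpleGraph V → ℂ}
    (hZ : DeletionContraction z Z) {ε r y : ℝ} {m : ℕ} (hε : 0 ≤ ε) (hr : 1 ≤ r)
    (hrε : r * (1 - ε) = 1) (hz : ‖z‖ * r ^ m ≤ ε) (hy : 0 ≤ y) (hym : (1 + ε * y) ^ m ≤ y)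
    (hyε : (y - 1) * (1 + ε) ≤ 1) {H : SimpleGraph V}
    (hH : ∀ w, (H.nbrs w).card ≤ m + 1) (hI : ∀ K < H, IdentifyBound Z m r K)
    (hS : ∀ K < H, ShiftBound Z m r K) : ShiftBound Z m r H := by
  intro u v X huv hadj hvm hX hXu
  induction X using Finset.induction_on with
  | empty =>
    have : H.shift u v ∅ = H := by ext s t; simp [shift, detach_adj, attach_adj]
    simp [this]
  | insert x X hx ih =>
    have hX' := (Finset.insert_subset_iff.1 hX).2
    have hvx : H.Adj v x := mem_nbrs.1 (hX (Finset.mem_insert_self _ _))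
    have hux : ¬H.Adj u x := fun h =>
      Finset.disjoint_left.1 hXu (Finset.mem_insert_self _ _) (mem_nbrs.2 h)
    have hune : u ≠ x := by rintro rfl; exact hadj hvx.symm
    have hXu' : Disjoint X (H.nbrs u) := hXu.mono_left (Finset.subset_insert _ _)
    have ih := ih hX' hXu'
    have hnbr : ∀ n, n ≠ u → n ≠ v → ∀ w, w ≠ u → w ≠ v →
        ((H.shift u v X).Adj n w ↔ H.Adj n w) := by
      intro n hnu hnv w hwu hwv
      simp [shift, attach_adj, detach_adj, hnu, hnv, hwu, hwv]
    have hsdiff : ∀ n, n ≠ u → n ≠ v → (H.shift u v X).nbrs n \ {u, v} ⊆ H.nbrs n := by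
      intro n hnu hnv w hw
      simp only [Finset.mem_sdiff, mem_nbrs, Finset.mem_insert, Finset.mem_singleton,
        not_or] at hw
      exact mem_nbrs.2 ((hnbr n hnu hnv w hw.2.1 hw.2.2).1 hw.1)
    have hlt : ∀ R, x ∈ R → H.isolate R < H := fun R hxR =>
      lt_of_le_of_ne (H.isolate_le R) fun h => by
        have h2 : (H.isolate R).Adj v x := by rwa [h]
        exact h2.2.2 hxR
    -- `b R` bounds the value on `H - R` with the edges in `X` moved and the edge `u v` added.
    have hdiff := (norm_attach_sub_attach_le hZ (H.shift u v X) hune hvx.ne huv hε hy hym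
      (fun R => r ^ X.card * (1 + ε) * ‖Z (H.isolate R)‖) ?_ ?_ ?_ {x} ((H.nbrs x).erase v)
      (Finset.mem_singleton_self _) (by simpa using hune) (by simpa using hvx.ne)
      (by simp) ?_).2 (by simpa [adj_comm] using fun _ => hux) (by simp)
    · rw [attach_isolate_shift_left H hvx hune hX', attach_isolate_shift_right H hvx hune hx]
        at hdiff
      have hd : (((H.nbrs x).erase v) \ {u, v}).card ≤ m := by
        refine (Finset.card_le_card Finset.sdiff_subset).trans ?_
        rw [Finset.card_erase_of_mem (mem_nbrs.2 hvx.symm)]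
        have := hH x
        omega
      have hiso : ‖Z (H.isolate {x})‖ ≤ r ^ (m + 1) * ‖Z H‖ := by
        have h0 : H.isolate ∅ = H := by ext s t; simp [isolate_adj]
        have := norm_isolate_insert_le hZ hr hrε hz hH hI ∅ x (d := m + 1) (by rw [h0]; exact hH x)
        rwa [h0, insert_empty_eq] at this
      have h1 : 1 ≤ 1 + ε * y := le_add_of_nonneg_right (mul_nonneg hε hy)
      have hpow : (1 + ε * y) ^ (((H.nbrs x).erase v) \ {u, v}).card - 1 ≤ y - 1 :=
        sub_le_sub_right ((pow_le_pow_right₀ h1 hd).trans hym) 1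
      have hy1 : 0 ≤ y - 1 := by linarith [(one_le_pow₀ h1 : 1 ≤ (1 + ε * y) ^ m)]
      have hbound : ‖Z (H.shift u v (insert x X)) - Z (H.shift u v X)‖ ≤
          ε * r * (r ^ X.card * ‖Z H‖) := by
        calc _ ≤ _ := hdiff
          _ ≤ ‖z‖ * ((y - 1) * (r ^ X.card * (1 + ε) * (r ^ (m + 1) * ‖Z H‖))) := by gcongr
          _ = ((y - 1) * (1 + ε)) * (‖z‖ * r ^ m) * (r * (r ^ X.card * ‖Z H‖)) := by ring
          _ ≤ 1 * ε * (r * (r ^ X.card * ‖Z H‖)) := by gcongr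
          _ = ε * r * (r ^ X.card * ‖Z H‖) := by ring
      calc ‖Z (H.shift u v (insert x X))‖
          ≤ ‖Z (H.shift u v X)‖ + ‖Z (H.shift u v (insert x X)) - Z (H.shift u v X)‖ :=
            norm_le_insert' _ _
        _ ≤ r ^ X.card * ‖Z H‖ + ε * r * (r ^ X.card * ‖Z H‖) := add_le_add ih hbound
        _ = (1 + ε * r) * (r ^ X.card * ‖Z H‖) := by ring
        _ = r * (r ^ X.card * ‖Z H‖) := by rw [show 1 + ε * r = r by linarith]
        _ = _ := by rw [Finset.card_insert_of_notMem hx, pow_succ]; ring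
    · intro R hxR huR hvR
      have hK := hlt R hxR
      have hKadj : ¬(H.isolate R).Adj u v := fun h => hadj h.1
      have hKv : ((H.isolate R).nbrs v).card ≤ m :=
        (card_nbrs_le_of_le (H.isolate_le R) v).trans hvm
      have hsub : X \ R ⊆ (H.isolate R).nbrs v := by
        intro w hw
        rw [Finset.mem_sdiff] at hw
        exact mem_nbrs.2 ⟨mem_nbrs.1 (hX' hw.1), hvR, hw.2⟩
      have hXadj : u ∉ X := fun h => hadj (mem_nbrs.1 (hX' h)).symm
      rw [isolate_shift H huR]
      have hna : ¬((H.isolate R).shift u v (X \ R)).Adj u v := by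
        have : v ∉ X := fun h => (mem_nbrs.1 (hX' h)).ne rfl
        simp [shift, attach_adj, detach_adj, isolate_adj, hadj, this, huv.symm]
      rw [hZ _ _ _ huv hna, identify_shift _ huv hsub]
      have hs := hS _ hK u v (X \ R) huv hKadj hKv hsub (by
        rw [Finset.disjoint_left]
        intro w hw hw2
        exact Finset.disjoint_left.1 hXu' (Finset.mem_sdiff.1 hw).1
          (mem_nbrs.2 (mem_nbrs.1 hw2).1))
      have hi := hI _ hK u v huv hKadj hKv
      calc _ ≤ ‖Z ((H.isolate R).shift u v (X \ R))‖ + ‖z‖ * ‖Z ((H.isolate R).identify u v)‖ := by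
            rw [← norm_mul]
            exact norm_add_le _ _
        _ ≤ r ^ (X \ R).card * ‖Z (H.isolate R)‖ + ‖z‖ * (r ^ m * ‖Z (H.isolate R)‖) := by
            gcongr
        _ = r ^ (X \ R).card * ‖Z (H.isolate R)‖ + 1 * (‖z‖ * r ^ m) * ‖Z (H.isolate R)‖ := by
            ring
        _ ≤ r ^ X.card * ‖Z (H.isolate R)‖ + r ^ X.card * ε * ‖Z (H.isolate R)‖ := by
            gcongr
            · exact Finset.sdiff_subset
            · exact one_le_pow₀ hr
        _ = _ := by ring
    · rintro R n hxR huR hvR hnR hnu hnv ⟨s, hsR, hsn⟩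
      have hsn' : H.Adj s n :=
        (hnbr s (fun h => huR (h ▸ hsR)) (fun h => hvR (h ▸ hsR)) n hnu hnv).1 hsn
      have hd : ((H.isolate R).nbrs n).card ≤ m := by
        refine Nat.le_of_lt_succ (lt_of_lt_of_le (Finset.card_lt_card ?_) (hH n))
        refine Finset.ssubset_iff_of_subset (nbrs_subset_of_le (H.isolate_le R) n) |>.2
          ⟨s, mem_nbrs.2 hsn'.symm, fun h => (mem_nbrs.1 h).2.2 hsR⟩
      have := norm_isolate_insert_le hZ hr hrε hz hH hI R n hd
      calc ‖z‖ * (r ^ X.card * (1 + ε) * ‖Z (H.isolate (insert n R))‖)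
          ≤ ‖z‖ * (r ^ X.card * (1 + ε) * (r ^ m * ‖Z (H.isolate R)‖)) := by gcongr
        _ = (‖z‖ * r ^ m) * (r ^ X.card * (1 + ε) * ‖Z (H.isolate R)‖) := by ring
        _ ≤ ε * (r ^ X.card * (1 + ε) * ‖Z (H.isolate R)‖) := by gcongr
    · intro n hnu hnv
      exact (Finset.card_le_card (hsdiff n hnu hnv)).trans (hH n)
    · intro n hn hnu hnv
      rw [Finset.mem_erase, mem_nbrs] at hn
      exact ⟨x, Finset.mem_singleton_self _, (hnbr x hune.symm hvx.ne' n hnu hnv).2 hn.2⟩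

theorem identifyBound_of_shiftBound [Fintype V] [DecidableEq V] {z : ℂ} {Z : SimpleGraph V → ℂ}
    (hZ : DeletionContraction z Z) {ε r : ℝ} {m : ℕ} (hr : 1 ≤ r)
    (hrε : r * (1 - ε) = 1) (hz : ‖z‖ * r ^ m ≤ ε) {H : SimpleGraph V}
    (hH : ∀ w, (H.nbrs w).card ≤ m + 1) (hI : ∀ K < H, IdentifyBound Z m r K)
    (hS : ∀ K ≤ H, ShiftBound Z m r K) : IdentifyBound Z m r H := by
  intro u v huv hadj hvm
  have h1 := norm_detach_le hZ hr hrε hz hH hI v (H.nbrs v ∩ H.nbrs u) Finset.inter_subset_left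
  have h2 := hS _ (H.detach_le v (H.nbrs v ∩ H.nbrs u)) u v (H.nbrs v \ H.nbrs u) huv
    (fun h => hadj h.1) ((card_nbrs_le_of_le (H.detach_le _ _) v).trans hvm) (by
      intro w hw
      simp only [Finset.mem_sdiff, mem_nbrs] at hw
      simp only [mem_nbrs, detach_adj, Finset.mem_inter]
      exact ⟨hw.1, fun h => hw.2 h.2.2, fun h => H.loopless.irrefl v h.2.1⟩) (by
      rw [Finset.disjoint_left]
      intro w hw hw2
      exact (Finset.mem_sdiff.1 hw).2 (mem_nbrs.2 (mem_nbrs.1 hw2).1))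
  rw [shift_detach_eq_identify H huv] at h2
  calc ‖Z (H.identify u v)‖ ≤ _ := h2
    _ ≤ r ^ (H.nbrs v \ H.nbrs u).card * (r ^ (H.nbrs v ∩ H.nbrs u).card * ‖Z H‖) := by gcongr
    _ = r ^ (H.nbrs v).card * ‖Z H‖ := by
      rw [← mul_assoc, ← pow_add, Finset.card_sdiff_add_card_inter]
    _ ≤ r ^ m * ‖Z H‖ := by gcongr

theorem identifyBound_and_shiftBound [Fintype V] [DecidableEq V] {z : ℂ} {Z : SimpleGraph V → ℂ}
    (hZ : DeletionContraction z Z) {ε r y : ℝ} {m : ℕ} (hε : 0 ≤ ε) (hr : 1 ≤ r)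
    (hrε : r * (1 - ε) = 1) (hz : ‖z‖ * r ^ m ≤ ε) (hy : 0 ≤ y) (hym : (1 + ε * y) ^ m ≤ y)
    (hyε : (y - 1) * (1 + ε) ≤ 1) (H : SimpleGraph V)
    (hH : ∀ w, (H.nbrs w).card ≤ m + 1) : IdentifyBound Z m r H ∧ ShiftBound Z m r H := by
  induction H using WellFoundedLT.induction with
  | ind H ih =>
    have ih' : ∀ K < H, IdentifyBound Z m r K ∧ ShiftBound Z m r K := fun K hK =>
      ih K hK fun w => (card_nbrs_le_of_le hK.le w).trans (hH w)
    have hS := shiftBound_of_lt hZ hε hr hrε hz hy hym hyε hH (fun K hK => (ih' K hK).1)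
      fun K hK => (ih' K hK).2
    refine ⟨identifyBound_of_shiftBound hZ hr hrε hz hH (fun K hK => (ih' K hK).1)
      fun K hK => ?_, hS⟩
    rcases hK.eq_or_lt with rfl | hK
    · exact hS
    · exact (ih' K hK).2

/-- Deleting the edges at one vertex after the other leads to the edgeless graph, with a bounded
loss at each deletion. -/
theorem ne_zero_of_deletionContraction [Fintype V] [DecidableEq V] {z : ℂ} {Z : SimpleGraph V → ℂ}
    (hZ : DeletionContraction z Z) (hbot : Z ⊥ ≠ 0) {ε r y : ℝ} {m : ℕ} (hε : 0 ≤ ε)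
    (hr : 1 ≤ r) (hrε : r * (1 - ε) = 1) (hz : ‖z‖ * r ^ m ≤ ε) (hy : 0 ≤ y)
    (hym : (1 + ε * y) ^ m ≤ y) (hyε : (y - 1) * (1 + ε) ≤ 1) (H : SimpleGraph V)
    (hH : ∀ w, (H.nbrs w).card ≤ m + 1) : Z H ≠ 0 := by
  have hI : ∀ K < H, IdentifyBound Z m r K := fun K hK =>
    (identifyBound_and_shiftBound hZ hε hr hrε hz hy hym hyε K
      fun w => (card_nbrs_le_of_le hK.le w).trans (hH w)).1
  intro h0
  have key : ∀ R : Finset V, Z (H.isolate R) = 0 := by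
    intro R
    induction R using Finset.induction_on with
    | empty =>
      have : H.isolate ∅ = H := by ext s t; simp [isolate_adj]
      rw [this, h0]
    | insert n R _ ih =>
      have := norm_isolate_insert_le hZ hr hrε hz hH hI R n le_rfl
      rw [ih, norm_zero, mul_zero] at this
      exact norm_le_zero_iff.1 this
  refine hbot ?_
  rw [← key Finset.univ]
  congr 1
  ext s t
  simp [isolate_adj]

end SimpleGraph

/-! ### Choice of the constants -/

theorem exp_two_thirds_le : Real.exp (2 / 3) ≤ 1.95 := by
  refine le_of_pow_le_pow_left₀ (n := 3) (by norm_num) (by norm_num) ?_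
  rw [← Real.exp_nat_mul, show ((3 : ℕ) : ℝ) * (2 / 3) = (2 : ℕ) * 1 by norm_num, Real.exp_nat_mul]
  calc Real.exp 1 ^ 2 ≤ 2.7182818286 ^ 2 := by
        gcongr
        exact Real.exp_one_lt_d9.le
    _ ≤ 1.95 ^ 3 := by norm_num

theorem exp_third_le : Real.exp (1 / 3) ≤ 17 / 12 := by
  refine le_of_pow_le_pow_left₀ (n := 3) (by norm_num) (by norm_num) ?_
  rw [← Real.exp_nat_mul, show ((3 : ℕ) : ℝ) * (1 / 3) = 1 by norm_num]
  exact Real.exp_one_lt_d9.le.trans (by norm_num)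

theorem one_add_pow_le_exp {x : ℝ} (hx : 0 ≤ x) (m : ℕ) : (1 + x) ^ m ≤ Real.exp (m * x) := by
  rw [Real.exp_nat_mul]
  gcongr
  linarith [Real.add_one_le_exp x]

/-- The condition on the tree weights `y = 2 - ε`, for `ε = 1 / (3 * (m + 1))`. -/
theorem one_add_mul_pow_le {ε : ℝ} {m : ℕ} (hε : 0 < ε) (hm : 3 * ((m : ℝ) + 1) * ε = 1) :
    (1 + ε * (2 - ε)) ^ m ≤ 2 - ε := by
  have hmε : (m : ℝ) * ε = 1 / 3 - ε := by linarith
  have hε3 : ε ≤ 1 / 3 := by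
    have : 0 ≤ (m : ℝ) * ε := by positivity
    linarith
  have h1 : (m : ℝ) * (ε * (2 - ε)) ≤ 2 / 3 + -(2 * ε) := by
    rw [← mul_assoc, hmε]
    nlinarith
  have h2 : Real.exp (-(2 * ε)) * (1 + 2 * ε) ≤ 1 := by
    rw [Real.exp_neg, inv_mul_le_iff₀ (Real.exp_pos _)]
    linarith [Real.add_one_le_exp (2 * ε)]
  have h3 : Real.exp (-(2 * ε)) ≤ 1 / (1 + 2 * ε) := by
    rwa [le_div_iff₀ (by linarith)]
  calc (1 + ε * (2 - ε)) ^ m ≤ Real.exp (m * (ε * (2 - ε))) :=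
        one_add_pow_le_exp (mul_nonneg hε.le (by linarith)) m
    _ ≤ Real.exp (2 / 3) * Real.exp (-(2 * ε)) := by
        rw [← Real.exp_add]
        exact Real.exp_le_exp.2 h1
    _ ≤ 1.95 * (1 / (1 + 2 * ε)) := by
        gcongr
        exact exp_two_thirds_le
    _ ≤ 2 - ε := by
        rw [mul_one_div, div_le_iff₀ (by linarith)]
        nlinarith

/-- The condition `t * r ^ m ≤ ε`, for `ε = 1 / (3 * (m + 1))` and `r = 1 / (1 - ε)`, follows from
`r ^ m ≤ exp (1 / 3) ≤ 17 / 12`; here `4.25 = 3 * (17 / 12)`. -/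
theorem mul_inv_pow_le {ε t : ℝ} {m : ℕ} (hε : 0 < ε) (hm : 3 * ((m : ℝ) + 1) * ε = 1)
    (ht : t ≤ 12 / 17 * ε) : t * ((1 - ε)⁻¹) ^ m ≤ ε := by
  have hmε : (m : ℝ) * ε = 1 / 3 - ε := by linarith
  have hε3 : ε ≤ 1 / 3 := by
    have : 0 ≤ (m : ℝ) * ε := by positivity
    linarith
  have h1 : (1 - ε)⁻¹ = 1 + ε * (1 - ε)⁻¹ := by
    field_simp [show (1 - ε) ≠ 0 by linarith]
    ring
  have h0 : 0 < (1 - ε)⁻¹ := inv_pos.2 (by linarith)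
  have h2 : ((1 - ε)⁻¹) ^ m ≤ 17 / 12 := by
    rw [h1]
    refine (one_add_pow_le_exp (by positivity) m).trans
      ((Real.exp_le_exp.2 ?_).trans exp_third_le)
    rw [← mul_assoc, hmε, ← div_eq_mul_inv, div_le_iff₀ (by linarith)]
    linarith
  calc t * ((1 - ε)⁻¹) ^ m ≤ (12 / 17 * ε) * (17 / 12) := by gcongr
    _ = ε := by ring

theorem theorem1 {V : Type*} [Fintype V] (G : SimpleGraph V) [DecidableRel G.Adj] (z : ℂ)
    (hz : G.chromaticPolynomial.eval z = 0) : ‖z‖ ≤ 4.25 * (G.maxDegree : ℝ) := by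
  classical
  by_contra! hlt
  have hz0 : z ≠ 0 := by
    rintro rfl
    rw [norm_zero] at hlt
    exact absurd hlt (not_lt.2 (by positivity))
  have hF : SimpleGraph.normalizedChromatic z G = 0 := by
    rw [SimpleGraph.normalizedChromatic, hz, zero_div]
  rcases Nat.eq_zero_or_pos G.maxDegree with hD | hD
  · have hG : G = ⊥ := by
      ext s t
      simp only [SimpleGraph.bot_adj, iff_false]
      intro h
      have h1 := G.degree_le_maxDegree s
      have h2 := (G.degree_pos_iff_exists_adj s).2 ⟨t, h⟩
      omega
    rw [hG, SimpleGraph.normalizedChromatic_bot hz0] at hF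
    exact one_ne_zero hF
  · obtain ⟨m, hm⟩ : ∃ m, G.maxDegree = m + 1 := ⟨G.maxDegree - 1, by omega⟩
    rw [hm] at hlt
    push_cast at hlt
    have hm1 : (0 : ℝ) < (m : ℝ) + 1 := by positivity
    obtain ⟨ε, hε⟩ : ∃ ε : ℝ, ε = 1 / (3 * ((m : ℝ) + 1)) := ⟨_, rfl⟩
    have hε0 : 0 < ε := by rw [hε]; positivity
    have hmε : 3 * ((m : ℝ) + 1) * ε = 1 := by rw [hε]; field_simp
    have hε3 : ε ≤ 1 / 3 := by
      have : 0 ≤ (m : ℝ) * ε := by positivity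
      linarith
    have hpos : 0 < ‖z‖ := norm_pos_iff.2 hz0
    have hnorm : ‖-z⁻¹‖ ≤ 12 / 17 * ε := by
      rw [norm_neg, norm_inv, inv_le_iff_one_le_mul₀ hpos]
      nlinarith
    refine SimpleGraph.ne_zero_of_deletionContraction (z := -z⁻¹) (ε := ε) (r := (1 - ε)⁻¹)
      (y := 2 - ε) (m := m) (fun K a b => K.normalizedChromatic_sup_edge hz0)
      (by rw [SimpleGraph.normalizedChromatic_bot hz0]; exact one_ne_zero) hε0.le
      (one_le_inv₀ (by linarith) |>.2 (by linarith)) (inv_mul_cancel₀ (by linarith))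
      (mul_inv_pow_le hε0 hmε hnorm) (by linarith) (one_add_mul_pow_le hε0 hmε)
      (by nlinarith) G (fun w => ?_) hF
    rw [← hm]
    refine le_trans (le_of_eq ?_) (G.degree_le_maxDegree w)
    rw [← SimpleGraph.card_neighborFinset_eq_degree]
    congr 1
    ext s
    simp
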